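/- Let $d\ge 1$, let $A,B\in\mathbb{R}^{d\times d}$ be symmetric positive definite, and let $\Sigma\in\mathbb{R}^{2d\times 2d}$ be symmetric positive definite, with inverse written in $d\times d$ blocks as $$\Gamma:=\Sigma^{-1}=\begin{pmatrix}\Gamma_{11}&\Gamma_{12}\\ \Gamma_{12}^T&\Gamma_{22}\end{pmatrix}.$$ Let $\mu=N_d(A)$, $\nu=N_d(B)$ and $N_{2d}(\Sigma)$ be the centered Gaussian measures on $\mathbb{R}^d$, $\mathbb{R}^d$ and $\mathbb{R}^d\times\mathbb{R}^d$ with covariance matrices $A$, $B$ and $\Sigma$. Let $\Pi(\mu,\nu)$ be the set of all probability measures on $\mathbb{R}^d\times\mathbb{R}^d$ with first marginal $\mu$ and second marginal $\nu$. Let $\mathrm{KL}(\pi|\rho)=\int\log\frac{d\pi}{d\rho}\,d\pi$ if $\pi\ll\rho$, and $\mathrm{KL}(\pi|\rho)=+\infty$ otherwise. For $\varepsilon>0$ put $M_\varepsilon:=I_d-\varepsilon\,\Gamma_{12}$. Then $M_\varepsilon$ is invertible for all sufficiently small $\varepsilon>0$. Moreover, for every $\varepsilon>0$ such that $M_\varepsilon$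 is invertible, the problem $$\inf_{\pi\in\Pi(\mu,\nu)}\int_{\mathbb{R}^d\times\mathbb{R}^d}\|x-y\|^2\,d\pi(x,y)+2\varepsilon\,\mathrm{KL}\big(\pi\,|\,N_{2d}(\Sigma)\big)$$ has a unique solution (minimizer in $\Pi(\mu,\nu)$). It is the centered Gaussian measure $$\pi_\varepsilon^\star=N_{2d}\begin{pmatrix}A&C_\varepsilon\\ C_\varepsilon^T&B\end{pmatrix},\qquad C_\varepsilon=\Big[\big(AM_\varepsilon BM_\varepsilon^T+\tfrac{\varepsilon^2}{4}I_d\big)^{1/2}-\tfrac{\varepsilon}{2}I_d\Big](M_\varepsilon^T)^{-1},$$ the displayed block matrix being positive semidefinite. Here the square root of the not necessarily symmetric matrix is defined by $$\big(AM_\varepsilon BM_\varepsilon^T+\tfrac{\varepsilon^2}{4}I_d\big)^{1/2}:=A^{1/2}\big(A^{1/2}M_\varepsilon BM_\varepsilon^TA^{1/2}+\tfrac{\varepsilon^2}{4}I_d\big)^{1/2}A^{-1/2},$$ where the square roots on the right are the positive semidefinite ones. -/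

import Mathlib

open MeasureTheory Filter Topology
open scoped ENNReal

namespace EntropicOT

/-- The Euclidean space `ℝ^d`. -/
abbrev Space (d : ℕ) : Type := EuclideanSpace ℝ (Fin d)

/-- `N_d(A)`: the centered Gaussian measure on `ℝ^d` with covariance matrix `A`. -/
noncomputable def gaussian {d : ℕ} (A : Matrix (Fin d) (Fin d) ℝ) : Measure (Space d) :=
  ProbabilityTheory.multivariateGaussian 0 A

/-- `N_{2d}(X)`: the centered Gaussian measure on `ℝ^d × ℝ^d` with covariance matrix `X`, where
the two copies of `Fin d` in `Fin d ⊕ Fin d` index the coordinates of the two factors. -/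
noncomputable def gaussianProd {d : ℕ} (X : Matrix (Fin d ⊕ Fin d) (Fin d ⊕ Fin d) ℝ) :
    Measure (Space d × Space d) :=
  (ProbabilityTheory.multivariateGaussian 0 X).map EuclideanSpace.sumEquivProd

/-- `Π(μ, ν)`: the probability measures on `ℝ^d × ℝ^d` with marginals `μ` and `ν`. -/
def couplings {d : ℕ} (μ ν : Measure (Space d)) : Set (Measure (Space d × Space d)) :=
  {π | IsProbabilityMeasure π ∧ π.map Prod.fst = μ ∧ π.map Prod.snd = ν}

/-- The objective `∫ ‖x - y‖² dπ(x, y) + 2 ε KL(π | πref)`, with values in `[0, ∞]`. -/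
noncomputable def objective {d : ℕ} (ε : ℝ) (πref π : Measure (Space d × Space d)) : ℝ≥0∞ :=
  ∫⁻ p, ENNReal.ofReal (‖p.1 - p.2‖ ^ 2) ∂π
    + ENNReal.ofReal (2 * ε) * InformationTheory.klDiv π πref

/-- `π` solves the entropic optimal transport problem between `μ` and `ν` with reference `πref`:
it is a coupling which minimizes the objective among all couplings. -/
def IsSolution {d : ℕ} (ε : ℝ) (πref : Measure (Space d × Space d)) (μ ν : Measure (Space d))
    (π : Measure (Space d × Space d)) : Prop :=
  π ∈ couplings μ ν ∧ IsMinOn (objective ε πref) (couplings μ ν) π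

/-- `M_ε = I - ε Γ₁₂`, where `Γ₁₂` is the upper right block of `Γ = S⁻¹`. -/
noncomputable def Meps {d : ℕ} (S : Matrix (Fin d ⊕ Fin d) (Fin d ⊕ Fin d) ℝ) (ε : ℝ) :
    Matrix (Fin d) (Fin d) ℝ :=
  1 - ε • (S⁻¹).toBlocks₁₂

section
open scoped MatrixOrder

/-- The square root `A^{1/2} (A^{1/2} N A^{1/2} + (ε²/4) I)^{1/2} A^{-1/2}` of the (not necessarily
symmetric) matrix `A N + (ε²/4) I`, for `A` positive definite and `N` positive semidefinite;
`CFC.sqrt` is the square root of positive semidefinite matrices. -/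
noncomputable def sqrtShift {d : ℕ} (A N : Matrix (Fin d) (Fin d) ℝ) (ε : ℝ) :
    Matrix (Fin d) (Fin d) ℝ :=
  CFC.sqrt A * CFC.sqrt (CFC.sqrt A * N * CFC.sqrt A + (ε ^ 2 / 4) • 1) * (CFC.sqrt A)⁻¹

end

/-- `C_ε = [(A M_ε B M_εᵀ + (ε²/4) I)^{1/2} - (ε/2) I] (M_εᵀ)⁻¹`. -/
noncomputable def Ceps {d : ℕ} (A B : Matrix (Fin d) (Fin d) ℝ)
    (S : Matrix (Fin d ⊕ Fin d) (Fin d ⊕ Fin d) ℝ) (ε : ℝ) : Matrix (Fin d) (Fin d) ℝ :=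
  (sqrtShift A (Meps S ε * B * (Meps S ε).transpose) ε - (ε / 2) • 1) * ((Meps S ε).transpose)⁻¹

/-- The block matrix with rows `(A, C)` and `(Cᵀ, B)`. -/
def covOf {d : ℕ} (A B C : Matrix (Fin d) (Fin d) ℝ) :
    Matrix (Fin d ⊕ Fin d) (Fin d ⊕ Fin d) ℝ :=
  Matrix.fromBlocks A C C.transpose B

end EntropicOT

/-! On couplings of `μ` and `ν`, the integral of `a(x) + b(y)` depends only on the marginals. Hence,
if `τ` is `ρ` tilted by `a(x) + b(y) - ‖x - y‖²/(2ε)`, the objective equals `2ε KL(π|τ)` plus a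
constant, and `τ`, as soon as it is a coupling, is the unique minimizer (`isSolution_tilted_iff`).
For Gaussians, `N(T)` is such a tilt of `N(S)` once `T⁻¹` has off-diagonal block `-ε⁻¹ M_ε`
(`exists_potentials`). With diagonal blocks `A`, `B` and Schur complement `A - C B⁻¹ Cᵀ = εG`, this
says `C = G M B`, so `G` solves `G M B Mᵀ G + εG = A`. Completing the square solves this equation
and produces `C_ε` (`exists_posDef_riccati`, `covOf_posDef_and_inv`). -/

namespace EntropicOT

section SquareRoot
open scoped MatrixOrder

variable {n : Type*} [Fintype n] [DecidableEq n]

lemma sqrt_mul_sqrt {A : Matrix n n ℝ} (hA : A.PosSemidef) : CFC.sqrt A * CFC.sqrt A = A :=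
  CFC.sqrt_mul_sqrt_self A hA.nonneg

lemma posDef_sqrt {A : Matrix n n ℝ} (hA : A.PosDef) : (CFC.sqrt A).PosDef := by
  have h : (CFC.sqrt A).PosSemidef := Matrix.nonneg_iff_posSemidef.1 (CFC.sqrt_nonneg A)
  refine h.posDef_iff_isUnit.2 ?_
  have hu := hA.isUnit
  rw [← sqrt_mul_sqrt hA.posSemidef] at hu
  exact isUnit_of_mul_isUnit_left hu

end SquareRoot

lemma isUnit_toEuclideanCLM_det {n : Type*} [Fintype n] [DecidableEq n] {Q : Matrix n n ℝ}
    (hQ : IsUnit Q) :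
    LinearMap.det (Matrix.toEuclideanCLM (𝕜 := ℝ) Q :
      EuclideanSpace ℝ n →ₗ[ℝ] EuclideanSpace ℝ n) ≠ 0 := by
  rw [Matrix.coe_toEuclideanCLM_eq_toEuclideanLin, Matrix.toEuclideanLin_eq_toLin_orthonormal,
    LinearMap.det_toLin]
  exact ((Matrix.isUnit_iff_isUnit_det _).1 hQ).ne_zero

/-! ### The Riccati equation and the candidate covariance. -/

section Covariance

variable {d : ℕ}

open scoped MatrixOrder in
/-- Factorization of `C_ε` through a positive definite matrix `G` solving the Riccati equation
`G N G + ε G = A`, where `N = M B Mᵀ`. -/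
lemma exists_posDef_riccati {A N : Matrix (Fin d) (Fin d) ℝ} (hA : A.PosDef) (hN : N.PosSemidef)
    {ε : ℝ} (hε : 0 < ε) :
    ∃ G : Matrix (Fin d) (Fin d) ℝ, G.PosDef ∧ G * N * G + ε • G = A ∧
      sqrtShift A N ε - (ε / 2) • 1 = G * N := by
  unfold sqrtShift
  have hR := posDef_sqrt hA
  have hRR := sqrt_mul_sqrt hA.posSemidef
  set R := CFC.sqrt A with hRdef
  set K := R * N * R with hK
  have hRt : R.conjTranspose = R := hR.isHermitian
  have hKps : K.PosSemidef := by
    have := hN.conjTranspose_mul_mul_same R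
    rwa [hRt] at this
  have hshift : (K + (ε ^ 2 / 4) • (1 : Matrix (Fin d) (Fin d) ℝ)).PosDef :=
    Matrix.PosDef.posSemidef_add hKps (Matrix.PosDef.one.smul (by positivity))
  have hT := posDef_sqrt hshift
  have hTT := sqrt_mul_sqrt hshift.posSemidef
  set T := CFC.sqrt (K + (ε ^ 2 / 4) • (1 : Matrix (Fin d) (Fin d) ℝ)) with hTdef
  -- With `G = R F R` the equation becomes `F K F + εF = 1`. Seeking `F = U⁻¹` gives `U² - εU = K`,
  -- that is `(U - ε/2)² = K + ε²/4`.
  have hU : (T + (ε / 2) • (1 : Matrix (Fin d) (Fin d) ℝ)).PosDef :=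
    hT.add (Matrix.PosDef.one.smul (by positivity))
  set U := T + (ε / 2) • (1 : Matrix (Fin d) (Fin d) ℝ) with hUdef
  have hUdet := (Matrix.isUnit_iff_isUnit_det _).1 hU.isUnit
  have hRdet := (Matrix.isUnit_iff_isUnit_det _).1 hR.isUnit
  set F := U⁻¹ with hF
  have hFU : F * U = 1 := Matrix.nonsing_inv_mul _ hUdet
  have hUF : U * F = 1 := Matrix.mul_nonsing_inv _ hUdet
  have hTU : T = U - (ε / 2) • (1 : Matrix (Fin d) (Fin d) ℝ) := by rw [hUdef]; abel
  have hKU : K = U * U - ε • U := by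
    have h : K = T * T - (ε ^ 2 / 4) • (1 : Matrix (Fin d) (Fin d) ℝ) := by rw [hTT]; abel
    rw [h, hTU]
    simp only [sub_mul, mul_sub, smul_mul_assoc, mul_smul_comm, one_mul, mul_one, smul_sub,
      smul_smul]
    module
  have hFK : F * K = U - ε • (1 : Matrix (Fin d) (Fin d) ℝ) := by
    rw [hKU, mul_sub, ← mul_assoc, hFU, one_mul, mul_smul_comm, hFU]
  have hFKF : F * K * F + ε • F = 1 := by
    rw [hFK, sub_mul, hUF, smul_mul_assoc, one_mul]; abel
  refine ⟨R * F * R, ?_, ?_, ?_⟩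
  · have := hU.inv.conjTranspose_mul_mul_same (B := R)
      (Matrix.mulVec_injective_iff_isUnit.2 hR.isUnit)
    rwa [hRt] at this
  · calc R * F * R * N * (R * F * R) + ε • (R * F * R)
        = R * (F * K * F + ε • F) * R := by
          rw [hK]; simp only [mul_add, add_mul, mul_assoc, smul_mul_assoc, mul_smul_comm]
      _ = A := by rw [hFKF, mul_one, hRR]
  · have hRi : R * R⁻¹ = 1 := Matrix.mul_nonsing_inv _ hRdet
    have hT' : T = F * K + (ε / 2) • (1 : Matrix (Fin d) (Fin d) ℝ) := by
      rw [hFK, hTU]; module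
    calc R * T * R⁻¹ - (ε / 2) • 1 = R * F * R * N * (R * R⁻¹) := by
          rw [hT', hK, mul_add, add_mul, mul_smul_comm, smul_mul_assoc, mul_one, hRi]
          simp only [mul_assoc, hRi, add_sub_cancel_right]
      _ = R * F * R * N := by rw [hRi, mul_one]

/-- If `C = G M B` with `G M B Mᵀ G + ε G = A`, then the covariance matrix with off-diagonal block
`C` is positive definite and the off-diagonal block of its inverse is `-ε⁻¹ M`. -/
lemma covOf_posDef_and_inv {A B G M : Matrix (Fin d) (Fin d) ℝ} (hB : B.PosDef) (hG : G.PosDef)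
    {ε : ℝ} (hε : 0 < ε) (hric : G * (M * B * M.transpose) * G + ε • G = A) :
    (covOf A B (G * M * B)).PosDef ∧
      (covOf A B (G * M * B))⁻¹ = Matrix.fromBlocks (ε⁻¹ • G⁻¹) (-(ε⁻¹ • M))
        (-(ε⁻¹ • M.transpose)) (B⁻¹ + ε⁻¹ • (M.transpose * G * M)) := by
  have hGt : G.transpose = G := hG.isHermitian
  have hBt : B.transpose = B := hB.isHermitian
  have hGdet := (Matrix.isUnit_iff_isUnit_det _).1 hG.isUnit
  have hBdet := (Matrix.isUnit_iff_isUnit_det _).1 hB.isUnit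
  have hGG : G * G⁻¹ = 1 := Matrix.mul_nonsing_inv _ hGdet
  have hBB : B * B⁻¹ = 1 := Matrix.mul_nonsing_inv _ hBdet
  have hCt : (G * M * B).transpose = B * M.transpose * G := by
    simp only [Matrix.transpose_mul, hGt, hBt, mul_assoc]
  have hprod : covOf A B (G * M * B) * Matrix.fromBlocks (ε⁻¹ • G⁻¹) (-(ε⁻¹ • M))
        (-(ε⁻¹ • M.transpose)) (B⁻¹ + ε⁻¹ • (M.transpose * G * M)) = 1 := by
    rw [covOf, hCt, Matrix.fromBlocks_multiply, ← Matrix.fromBlocks_one, ← hric]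
    congr 1
    · simp only [add_mul, mul_assoc, mul_smul_comm, smul_mul_assoc, mul_neg, hGG, mul_one,
        smul_add, smul_smul, inv_mul_cancel₀ hε.ne', one_smul]
      abel
    · simp only [add_mul, mul_add, mul_assoc, mul_smul_comm, smul_mul_assoc, mul_neg, hBB, mul_one,
        smul_add, smul_smul, inv_mul_cancel₀ hε.ne', one_smul]
      abel
    · simp only [mul_assoc, mul_smul_comm, mul_neg, hGG, mul_one]
      abel
    · simp only [mul_add, mul_assoc, mul_smul_comm, mul_neg, hBB]
      abel
  refine ⟨?_, Matrix.inv_eq_right_inv hprod⟩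
  have hps : (covOf A B (G * M * B)).PosSemidef := by
    let : Invertible B := Matrix.invertibleOfIsUnitDet _ hBdet
    refine (Matrix.PosDef.fromBlocks₂₂ A (G * M * B) hB).2 ?_
    have : A - G * M * B * B⁻¹ * (G * M * B).conjTranspose = ε • G := by
      rw [Matrix.conjTranspose_eq_transpose_of_trivial, hCt, mul_assoc (G * M) B, hBB, ← hric]
      simp only [mul_assoc, one_mul]
      abel
    rw [this]
    exact (hG.smul hε).posSemidef
  exact hps.posDef_iff_isUnit.2 ((Matrix.isUnit_iff_isUnit_det _).2
    (Matrix.isUnit_det_of_right_inverse hprod))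

lemma covOf_Ceps_posDef_and_inv {A B : Matrix (Fin d) (Fin d) ℝ} (hA : A.PosDef) (hB : B.PosDef)
    (S : Matrix (Fin d ⊕ Fin d) (Fin d ⊕ Fin d) ℝ) {ε : ℝ} (hε : 0 < ε)
    (hM : IsUnit (Meps S ε)) :
    (covOf A B (Ceps A B S ε)).PosDef ∧
      ∃ P Q : Matrix (Fin d) (Fin d) ℝ, (covOf A B (Ceps A B S ε))⁻¹ =
        Matrix.fromBlocks P (-(ε⁻¹ • Meps S ε)) (-(ε⁻¹ • (Meps S ε).transpose)) Q := by
  have hN : (Meps S ε * B * (Meps S ε).transpose).PosSemidef := by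
    simpa using hB.posSemidef.mul_mul_conjTranspose_same (Meps S ε)
  obtain ⟨G, hG, hric, hC⟩ := exists_posDef_riccati hA hN hε
  have hMt : (Meps S ε).transpose * ((Meps S ε).transpose)⁻¹ = 1 :=
    Matrix.mul_nonsing_inv _ (by
      rw [Matrix.det_transpose]; exact (Matrix.isUnit_iff_isUnit_det _).1 hM)
  -- Invertibility of `M` serves only to cancel `Mᵀ (Mᵀ)⁻¹`.
  have hCG : Ceps A B S ε = G * Meps S ε * B := by
    rw [Ceps, hC]
    simp only [mul_assoc, hMt, mul_one]
  rw [hCG]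
  obtain ⟨h1, h2⟩ := covOf_posDef_and_inv hB hG hε hric
  exact ⟨h1, _, _, h2⟩

/-- The determinant is continuous in `ε` and equals 1 at `ε = 0`. -/
lemma eventually_isUnit_Meps (S : Matrix (Fin d ⊕ Fin d) (Fin d ⊕ Fin d) ℝ) :
    ∀ᶠ ε in 𝓝[>] (0 : ℝ), IsUnit (Meps S ε) := by
  have hcont : Continuous fun ε : ℝ => (Meps S ε).det := by unfold Meps; fun_prop
  have h0 : (Meps S 0).det ≠ 0 := by simp [Meps]
  filter_upwards [nhdsWithin_le_nhds (hcont.continuousAt.eventually_ne h0)] with ε h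
  exact (Matrix.isUnit_iff_isUnit_det _).2 (isUnit_iff_ne_zero.2 h)

end Covariance

/-! ### Exponential tilts of measures. -/

section Tilted

variable {α β : Type*} [MeasurableSpace α] [MeasurableSpace β]

lemma map_tilted_comp (μ : Measure α) {g : α → β} (hg : Measurable g) {f : β → ℝ}
    (hf : Measurable f) : (μ.tilted (f ∘ g)).map g = (μ.map g).tilted f := by
  ext s hs
  have hint : ∫ y, Real.exp (f y) ∂(μ.map g) = ∫ x, Real.exp (f (g x)) ∂μ :=
    integral_map hg.aemeasurable (by fun_prop)
  rw [Measure.map_apply hg hs, tilted_apply' _ _ (hg hs), tilted_apply' _ _ hs,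
    setLIntegral_map hs (by fun_prop) hg, hint]
  rfl

/-- The normalization cancels `c`; this absorbs the Jacobian of a linear change of variables. -/
lemma smul_tilted (μ : Measure α) {c : ℝ≥0∞} (h0 : c ≠ 0) (htop : c ≠ ∞) (f : α → ℝ) :
    (c • μ).tilted f = μ.tilted f := by
  ext s hs
  have hc : 0 < c.toReal := ENNReal.toReal_pos h0 htop
  rw [tilted_apply' _ _ hs, tilted_apply' _ _ hs, Measure.restrict_smul, lintegral_smul_measure,
    integral_smul_measure, smul_eq_mul, smul_eq_mul, ← lintegral_const_mul' _ _ htop]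
  refine lintegral_congr fun x => ?_
  nth_rewrite 1 [← ENNReal.ofReal_toReal htop]
  rw [← ENNReal.ofReal_mul hc.le]
  congr 1
  field_simp

/-- A tilt by a non-integrable exponential is the zero measure by default. -/
lemma integrable_exp_of_tilted_ne_zero {μ : Measure α} {f : α → ℝ} (h : μ.tilted f ≠ 0) :
    Integrable (fun x => Real.exp (f x)) μ := by
  by_contra hf
  exact h (tilted_of_not_integrable hf)

end Tilted

/-! ### Gaussian densities. -/

section Density

open ProbabilityTheory

/-- Characteristic functions agree: the Fourier integral of the Gaussian carries the same constant
as the normalization. -/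
lemma stdGaussian_eq_tilted (E : Type*) [NormedAddCommGroup E] [InnerProductSpace ℝ E]
    [FiniteDimensional ℝ E] [MeasurableSpace E] [BorelSpace E] :
    stdGaussian E = (volume : Measure E).tilted fun x => -(‖x‖ ^ 2 / 2) := by
  have hre : 0 < ((1 / 2 : ℂ)).re := by norm_num
  have hI := GaussianFourier.integral_cexp_neg_mul_sq_norm_add (V := E) hre Complex.I
  have hexp : ∀ x : E, ((Real.exp (-(‖x‖ ^ 2 / 2)) : ℝ) : ℂ) =
      Complex.exp (-(1 / 2 : ℂ) * (‖x‖ : ℂ) ^ 2) := by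
    intro x
    push_cast
    congr 1
    ring
  have hint : Integrable (fun x : E => Real.exp (-(‖x‖ ^ 2 / 2))) volume := by
    have h := (GaussianFourier.integrable_cexp_neg_mul_sq_norm_add (V := E) hre 0 0).re
    refine h.congr (ae_of_all _ fun x => ?_)
    have h2 := hexp x
    simp only [zero_mul, add_zero]
    rw [← h2]
    exact Complex.ofReal_re _
  have : IsProbabilityMeasure ((volume : Measure E).tilted fun x => -(‖x‖ ^ 2 / 2)) :=
    isProbabilityMeasure_tilted hint
  refine Measure.ext_of_charFun (funext fun t => ?_)
  have hZ : ((∫ x : E, Real.exp (-(‖x‖ ^ 2 / 2)) : ℝ) : ℂ) =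
      (Real.pi / (1 / 2 : ℂ)) ^ (Module.finrank ℝ E / 2 : ℂ) := by
    rw [← integral_complex_ofReal, ← GaussianFourier.integral_cexp_neg_mul_sq_norm (V := E) hre]
    exact integral_congr_ae (ae_of_all _ hexp)
  have hZ0 : ((∫ x : E, Real.exp (-(‖x‖ ^ 2 / 2)) : ℝ) : ℂ) ≠ 0 :=
    Complex.ofReal_ne_zero.2 (integral_exp_pos hint).ne'
  rw [charFun_stdGaussian, charFun_apply, integral_tilted]
  have hstep : ∀ x : E, (Real.exp (-(‖x‖ ^ 2 / 2)) / ∫ x : E, Real.exp (-(‖x‖ ^ 2 / 2))) •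
      Complex.exp ((inner ℝ x t : ℝ) * Complex.I) =
      ((∫ x : E, Real.exp (-(‖x‖ ^ 2 / 2)) : ℝ) : ℂ)⁻¹ *
        Complex.exp (-(1 / 2 : ℂ) * (‖x‖ : ℂ) ^ 2 + Complex.I * (inner ℝ t x : ℝ)) := by
    intro x
    rw [Complex.exp_add, ← hexp, Complex.real_smul, real_inner_comm, mul_comm Complex.I]
    push_cast
    ring
  simp_rw [hstep]
  rw [integral_const_mul, hI t, ← hZ, inv_mul_cancel_left₀ hZ0]
  congr 1
  rw [Complex.I_sq]
  ring

variable {n : Type*} [Fintype n] [DecidableEq n]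

open scoped MatrixOrder in
-- Change of variables by `Q = S^{1/2}`, under which `zᵀ S⁻¹ z` pulls back to `‖x‖²`.
lemma multivariateGaussian_eq_tilted {S : Matrix n n ℝ} (hS : S.PosDef) :
    multivariateGaussian 0 S = (volume : Measure (EuclideanSpace ℝ n)).tilted
      fun z => -((z.ofLp ⬝ᵥ S⁻¹.mulVec z.ofLp) / 2) := by
  have hQ := posDef_sqrt hS
  have hQQ := sqrt_mul_sqrt hS.posSemidef
  rw [multivariateGaussian]
  simp only [zero_add]
  set Q := CFC.sqrt S
  have hQt : Q.transpose = Q := hQ.isHermitian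
  have hQdet := (Matrix.isUnit_iff_isUnit_det _).1 hQ.isUnit
  have hQSQ : Q * (S⁻¹ * Q) = 1 := by
    rw [← hQQ, Matrix.mul_inv_rev, mul_assoc, Matrix.nonsing_inv_mul _ hQdet, mul_one,
      Matrix.mul_nonsing_inv _ hQdet]
  have hdet := isUnit_toEuclideanCLM_det hQ.isUnit
  have hcomp : (fun x : EuclideanSpace ℝ n => -(‖x‖ ^ 2 / 2)) =
      (fun z : EuclideanSpace ℝ n => -((z.ofLp ⬝ᵥ S⁻¹.mulVec z.ofLp) / 2)) ∘
        Matrix.toEuclideanCLM (𝕜 := ℝ) Q := by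
    funext x
    have hT : (S⁻¹ * Q).transpose * Q = 1 := by
      rw [← Matrix.transpose_one, ← hQSQ, Matrix.transpose_mul Q, hQt]
    have h : Q.mulVec x.ofLp ⬝ᵥ S⁻¹.mulVec (Q.mulVec x.ofLp) = ‖x‖ ^ 2 := by
      rw [Matrix.mulVec_mulVec, Matrix.dotProduct_mulVec, ← Matrix.mulVec_transpose,
        Matrix.mulVec_mulVec, hT, Matrix.one_mulVec, EuclideanSpace.real_norm_sq_eq]
      simp [dotProduct, sq]
    rw [Function.comp_apply, Matrix.ofLp_toEuclideanCLM, h]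
  rw [stdGaussian_eq_tilted, hcomp, map_tilted_comp _ (by fun_prop) (by fun_prop)]
  have hmap := Measure.map_linearMap_addHaar_eq_smul_addHaar
    (volume : Measure (EuclideanSpace ℝ n)) hdet
  rw [ContinuousLinearMap.coe_coe] at hmap
  rw [hmap, smul_tilted _ _ ENNReal.ofReal_ne_top]
  simpa using hdet

lemma multivariateGaussian_eq_tilted_multivariateGaussian {S T : Matrix n n ℝ} (hS : S.PosDef)
    (hT : T.PosDef) : multivariateGaussian 0 T = (multivariateGaussian 0 S).tilted
      fun z => (z.ofLp ⬝ᵥ (S⁻¹ - T⁻¹).mulVec z.ofLp) / 2 := by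
  have hint : Integrable (fun z : EuclideanSpace ℝ n =>
      Real.exp (-((z.ofLp ⬝ᵥ S⁻¹.mulVec z.ofLp) / 2))) volume :=
    integrable_exp_of_tilted_ne_zero (by
      rw [← multivariateGaussian_eq_tilted hS]; exact IsProbabilityMeasure.ne_zero _)
  rw [multivariateGaussian_eq_tilted hS, multivariateGaussian_eq_tilted hT, tilted_tilted hint]
  congr 1
  funext z
  simp only [Pi.add_apply, Matrix.sub_mulVec, dotProduct_sub]
  ring

end Density

open ProbabilityTheory InformationTheory

/-! ### Gaussian couplings and their quadratic potentials. -/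

section Coupling

variable {d : ℕ}

instance (X : Matrix (Fin d ⊕ Fin d) (Fin d ⊕ Fin d) ℝ) : IsProbabilityMeasure (gaussianProd X) :=
  Measure.isProbabilityMeasure_map (by fun_prop)

lemma ofLp_sumEquivProd_fst (z : EuclideanSpace ℝ (Fin d ⊕ Fin d)) :
    (EuclideanSpace.sumEquivProd z).1.ofLp = fun i => z.ofLp (Sum.inl i) := rfl

lemma ofLp_sumEquivProd_snd (z : EuclideanSpace ℝ (Fin d ⊕ Fin d)) :
    (EuclideanSpace.sumEquivProd z).2.ofLp = fun i => z.ofLp (Sum.inr i) := rfl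

lemma ofLp_sumEquivProd_symm (p : Space d × Space d) :
    (EuclideanSpace.sumEquivProd.symm p).ofLp = Sum.elim p.1.ofLp p.2.ofLp := by
  obtain ⟨z, rfl⟩ := EuclideanSpace.sumEquivProd.surjective p
  rw [ContinuousLinearEquiv.symm_apply_apply, ofLp_sumEquivProd_fst, ofLp_sumEquivProd_snd]
  funext i
  cases i <;> rfl

lemma map_multivariateGaussian_comp_index {m n : Type*} [Fintype m] [DecidableEq m] [Fintype n]
    [DecidableEq n] {T : Matrix n n ℝ} (hT : T.PosSemidef) (g : m → n)
    {L : EuclideanSpace ℝ n → EuclideanSpace ℝ m} (hLm : Measurable L)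
    (hL : ∀ z i, (L z).ofLp i = z.ofLp (g i)) :
    (multivariateGaussian 0 T).map L = multivariateGaussian 0 (T.submatrix g g) := by
  have := Measure.isProbabilityMeasure_map (μ := multivariateGaussian 0 T) hLm.aemeasurable
  refine Measure.ext_of_charFun (funext fun t => ?_)
  -- `s` is the adjoint of `L` applied to `t`; the sum allows a non-injective `g`.
  set s : EuclideanSpace ℝ n :=
    WithLp.toLp 2 (fun j => ∑ i, if g i = j then t.ofLp i else 0) with hs
  have hsum : ∀ f : n → ℝ, s.ofLp ⬝ᵥ f = t.ofLp ⬝ᵥ (f ∘ g) := by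
    intro f
    simp only [hs, dotProduct, Finset.sum_mul, ite_mul, zero_mul, Function.comp_apply]
    rw [Finset.sum_comm]
    simp
  have hinner : ∀ z, inner ℝ (L z) t = inner ℝ z s := by
    intro z
    have h := hsum z.ofLp
    simp only [EuclideanSpace.inner_eq_star_dotProduct, star_trivial]
    rw [h]
    congr 1
    funext i
    exact hL z i
  have h1 : charFun ((multivariateGaussian 0 T).map L) t = charFun (multivariateGaussian 0 T) s := by
    rw [charFun_apply, charFun_apply, integral_map hLm.aemeasurable (by fun_prop)]
    simp_rw [hinner]
  have h2 : s.ofLp ⬝ᵥ T.mulVec s.ofLp = t.ofLp ⬝ᵥ (T.submatrix g g).mulVec t.ofLp := by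
    rw [hsum]
    congr 1
    funext i
    have h := hsum (fun j => T (g i) j)
    simp only [Function.comp_apply, Matrix.mulVec, Matrix.submatrix_apply]
    rw [dotProduct_comm, h, dotProduct_comm]
    rfl
  rw [h1, charFun_multivariateGaussian hT, charFun_multivariateGaussian (hT.submatrix g), h2]
  simp

lemma gaussianProd_covOf_mem_couplings {A B C : Matrix (Fin d) (Fin d) ℝ}
    (h : (covOf A B C).PosSemidef) :
    gaussianProd (covOf A B C) ∈ couplings (gaussian A) (gaussian B) := by
  refine ⟨inferInstance, ?_, ?_⟩
  · rw [gaussianProd, Measure.map_map measurable_fst (by fun_prop),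
      map_multivariateGaussian_comp_index h Sum.inl (by fun_prop) fun z i => rfl]
    rfl
  · rw [gaussianProd, Measure.map_map measurable_snd (by fun_prop),
      map_multivariateGaussian_comp_index h Sum.inr (by fun_prop) fun z i => rfl]
    rfl

lemma integrable_norm_sq_gaussian (A : Matrix (Fin d) (Fin d) ℝ) :
    Integrable (fun x : Space d => ‖x‖ ^ 2) (gaussian A) :=
  (IsGaussian.memLp_two_id (μ := multivariateGaussian 0 A)).integrable_norm_pow (by norm_num)

lemma integrable_quadratic_gaussian (A P : Matrix (Fin d) (Fin d) ℝ) :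
    Integrable (fun x : Space d => x.ofLp ⬝ᵥ P.mulVec x.ofLp) (gaussian A) := by
  refine ((integrable_norm_sq_gaussian A).const_mul ‖Matrix.toEuclideanCLM (𝕜 := ℝ) P‖).mono'
    (Continuous.aestronglyMeasurable (by fun_prop)) (ae_of_all _ fun x => ?_)
  rw [← Matrix.inner_toEuclideanCLM]
  calc ‖inner ℝ x (Matrix.toEuclideanCLM (𝕜 := ℝ) P x)‖
      ≤ ‖x‖ * (‖Matrix.toEuclideanCLM (𝕜 := ℝ) P‖ * ‖x‖) :=
        (norm_inner_le_norm _ _).trans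
          (mul_le_mul_of_nonneg_left (ContinuousLinearMap.le_opNorm _ _) (norm_nonneg _))
    _ = _ := by ring

/-- If `S⁻¹ - T⁻¹` has off-diagonal blocks `ε⁻¹ I`, then `N_{2d}(T)` is the exponential tilt of
`N_{2d}(S)` by a sum of quadratic potentials minus the cost divided by `2 ε`. -/
lemma exists_potentials {S T : Matrix (Fin d ⊕ Fin d) (Fin d ⊕ Fin d) ℝ} (hS : S.PosDef)
    (hT : T.PosDef) {ε : ℝ} (hε : 0 < ε) {P Q : Matrix (Fin d) (Fin d) ℝ}
    (hST : S⁻¹ - T⁻¹ = Matrix.fromBlocks P (ε⁻¹ • 1) (ε⁻¹ • 1) Q) :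
    ∃ a b : Space d → ℝ, Continuous a ∧ Continuous b ∧
      (∀ A, Integrable a (gaussian A)) ∧ (∀ B, Integrable b (gaussian B)) ∧
      gaussianProd T = (gaussianProd S).tilted
        fun p => a p.1 + b p.2 - ‖p.1 - p.2‖ ^ 2 / (2 * ε) := by
  -- The squared norms cancel those in the cost, leaving the cross term `⟨x, y⟩/ε` that the
  -- off-diagonal blocks produce.
  refine ⟨fun x => x.ofLp ⬝ᵥ P.mulVec x.ofLp / 2 + ‖x‖ ^ 2 / (2 * ε),
    fun y => y.ofLp ⬝ᵥ Q.mulVec y.ofLp / 2 + ‖y‖ ^ 2 / (2 * ε), by fun_prop, by fun_prop,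
    fun A => ((integrable_quadratic_gaussian A P).div_const _).add
      ((integrable_norm_sq_gaussian A).div_const _),
    fun B => ((integrable_quadratic_gaussian B Q).div_const _).add
      ((integrable_norm_sq_gaussian B).div_const _), ?_⟩
  rw [gaussianProd, multivariateGaussian_eq_tilted_multivariateGaussian hS hT, gaussianProd,
    ← map_tilted_comp _ (by fun_prop) (by fun_prop)]
  congr 2
  funext z
  obtain ⟨p, rfl⟩ := EuclideanSpace.sumEquivProd.symm.surjective z
  rw [Function.comp_apply, ContinuousLinearEquiv.apply_symm_apply, ofLp_sumEquivProd_symm, hST,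
    Matrix.fromBlocks_mulVec]
  have hinner : p.2.ofLp ⬝ᵥ p.1.ofLp = inner ℝ p.1 p.2 := by
    simp [EuclideanSpace.inner_eq_star_dotProduct]
  simp only [Sum.elim_comp_inl, Sum.elim_comp_inr, sumElim_dotProduct_sumElim, dotProduct_add,
    Matrix.smul_mulVec, Matrix.one_mulVec, dotProduct_smul, smul_eq_mul, norm_sub_sq_real,
    dotProduct_comm p.1.ofLp p.2.ofLp, hinner]
  field_simp
  ring

end Coupling

/-! ### The objective as a divergence from the tilt. -/

section Objective

variable {d : ℕ}

/-- The objective of the entropic problem is, up to an additive constant, the divergence from a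
tilt of the reference measure by a sum of potentials minus the cost divided by `2 ε`. -/
lemma exists_objective_eq {μ ν : Measure (Space d)} {ρ : Measure (Space d × Space d)}
    [IsProbabilityMeasure ρ] (hμ : Integrable (fun x : Space d => ‖x‖ ^ 2) μ)
    (hν : Integrable (fun y : Space d => ‖y‖ ^ 2) ν) {a b : Space d → ℝ} (hac : Continuous a)
    (hbc : Continuous b) (ha : Integrable a μ) (hb : Integrable b ν) {ε : ℝ} (hε : 0 < ε)
    (hexp : Integrable
      (fun p : Space d × Space d => Real.exp (a p.1 + b p.2 - ‖p.1 - p.2‖ ^ 2 / (2 * ε))) ρ) :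
    ∃ c : ℝ, ∀ π ∈ couplings μ ν,
      (klDiv π (ρ.tilted fun p => a p.1 + b p.2 - ‖p.1 - p.2‖ ^ 2 / (2 * ε)) = ∞ →
        objective ε ρ π = ∞) ∧
      (klDiv π (ρ.tilted fun p => a p.1 + b p.2 - ‖p.1 - p.2‖ ^ 2 / (2 * ε)) ≠ ∞ →
        objective ε ρ π ≠ ∞ ∧ (objective ε ρ π).toReal = 2 * ε *
          (klDiv π (ρ.tilted fun p => a p.1 + b p.2 - ‖p.1 - p.2‖ ^ 2 / (2 * ε))).toReal + c) := by
  set h : Space d × Space d → ℝ := fun p => a p.1 + b p.2 - ‖p.1 - p.2‖ ^ 2 / (2 * ε) with hh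
  have : IsProbabilityMeasure (ρ.tilted h) := isProbabilityMeasure_tilted hexp
  -- From `KL(π|τ) = KL(π|ρ) - ∫ h dπ + log Z`: the cost inside `h` cancels the transport cost.
  refine ⟨2 * ε * ((∫ x, a x ∂μ + ∫ y, b y ∂ν) - Real.log (∫ p, Real.exp (h p) ∂ρ)), ?_⟩
  rintro π ⟨hπ, hfst, hsnd⟩
  have hfi : ∀ {f : Space d → ℝ}, Integrable f μ → Integrable (fun p => f p.1) π := fun hf =>
    (hfst ▸ hf : Integrable _ (π.map Prod.fst)).comp_measurable measurable_fst
  have hsi : ∀ {f : Space d → ℝ}, Integrable f ν → Integrable (fun p => f p.2) π := fun hf =>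
    (hsnd ▸ hf : Integrable _ (π.map Prod.snd)).comp_measurable measurable_snd
  have hcost : Integrable (fun p : Space d × Space d => ‖p.1 - p.2‖ ^ 2) π := by
    refine (((hfi hμ).add (hsi hν)).const_mul 2).mono'
      (Continuous.aestronglyMeasurable (by fun_prop)) (ae_of_all _ fun p => ?_)
    rw [Real.norm_of_nonneg (by positivity)]
    have h1 := parallelogram_law_with_norm ℝ p.1 p.2
    simp only [Pi.add_apply]
    nlinarith [sq_nonneg ‖p.1 + p.2‖]
  have hcost0 : 0 ≤ ∫ p, ‖p.1 - p.2‖ ^ 2 ∂π := integral_nonneg fun p => by positivity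
  have hcl : ∫⁻ p, ENNReal.ofReal (‖p.1 - p.2‖ ^ 2) ∂π =
      ENNReal.ofReal (∫ p, ‖p.1 - p.2‖ ^ 2 ∂π) :=
    (ofReal_integral_eq_lintegral_ofReal hcost (ae_of_all _ fun p => by positivity)).symm
  have hab : Integrable (fun p : Space d × Space d => a p.1 + b p.2) π := (hfi ha).add (hsi hb)
  have hhi : Integrable h π := hab.sub (hcost.div_const _)
  have hhint : ∫ p, h p ∂π =
      ∫ x, a x ∂μ + ∫ y, b y ∂ν - (∫ p, ‖p.1 - p.2‖ ^ 2 ∂π) / (2 * ε) := by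
    rw [hh, integral_sub hab (hcost.div_const _), integral_add (hfi ha) (hsi hb),
      integral_div, ← hfst, ← hsnd, integral_map (by fun_prop) (by fun_prop),
      integral_map (by fun_prop) (by fun_prop)]
  -- The two log-likelihood ratios differ by `h - log Z`, which is `π`-integrable.
  have hkl : klDiv π ρ = ∞ ↔ klDiv π (ρ.tilted h) = ∞ := by
    rw [← not_iff_not, ← ne_eq, ← ne_eq, klDiv_ne_top_iff, klDiv_ne_top_iff]
    constructor
    · rintro ⟨hac, hint⟩
      exact ⟨hac.trans (absolutelyContinuous_tilted hexp),
        integrable_llr_tilted_right hac hhi hint hexp⟩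
    · rintro ⟨hac, hint⟩
      have hac' := hac.trans (tilted_absolutelyContinuous ρ h)
      refine ⟨hac', ?_⟩
      have h1 := ((integrable_congr (llr_tilted_right hac' hexp)).1 hint).add
        (hhi.sub (integrable_const (Real.log (∫ p, Real.exp (h p) ∂ρ))))
      refine h1.congr (ae_of_all _ fun p => ?_)
      simp only [Pi.add_apply, Pi.sub_apply]
      ring
  have h2ε : ENNReal.ofReal (2 * ε) ≠ 0 := by simpa using hε
  refine ⟨fun htop => ?_, fun hne => ?_⟩
  · rw [objective, hkl.2 htop, ENNReal.mul_top h2ε, add_top]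
  · have hne' : klDiv π ρ ≠ ∞ := fun hc => hne (hkl.1 hc)
    obtain ⟨hac, hint⟩ := klDiv_ne_top_iff.1 hne'
    have hmul : ENNReal.ofReal (2 * ε) * klDiv π ρ ≠ ∞ :=
      ENNReal.mul_ne_top ENNReal.ofReal_ne_top hne'
    refine ⟨by rw [objective, hcl]; exact ENNReal.add_ne_top.2 ⟨ENNReal.ofReal_ne_top, hmul⟩, ?_⟩
    rw [objective, hcl, ENNReal.toReal_add ENNReal.ofReal_ne_top hmul, ENNReal.toReal_mul,
      ENNReal.toReal_ofReal hcost0, ENNReal.toReal_ofReal (by positivity),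
      toReal_klDiv_of_measure_eq hac (by simp),
      toReal_klDiv_of_measure_eq (hac.trans (absolutelyContinuous_tilted hexp)) (by simp),
      integral_llr_tilted_right hac hhi hexp hint, hhint]
    field_simp
    ring

/-- The divergence from the tilt is nonnegative and vanishes only at the tilt itself. -/
lemma isSolution_tilted_iff {μ ν : Measure (Space d)} {ρ : Measure (Space d × Space d)}
    [IsProbabilityMeasure ρ] (hμ : Integrable (fun x : Space d => ‖x‖ ^ 2) μ)
    (hν : Integrable (fun y : Space d => ‖y‖ ^ 2) ν) {a b : Space d → ℝ} (hac : Continuous a)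
    (hbc : Continuous b) (ha : Integrable a μ) (hb : Integrable b ν) {ε : ℝ} (hε : 0 < ε)
    (hmem : (ρ.tilted fun p => a p.1 + b p.2 - ‖p.1 - p.2‖ ^ 2 / (2 * ε)) ∈ couplings μ ν)
    (π : Measure (Space d × Space d)) :
    IsSolution ε ρ μ ν π ↔
      π = ρ.tilted fun p => a p.1 + b p.2 - ‖p.1 - p.2‖ ^ 2 / (2 * ε) := by
  have hprob := hmem.1
  obtain ⟨c, hc⟩ := exists_objective_eq hμ hν hac hbc ha hb hε
    (integrable_exp_of_tilted_ne_zero hprob.ne_zero)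
  set τ := ρ.tilted fun p => a p.1 + b p.2 - ‖p.1 - p.2‖ ^ 2 / (2 * ε)
  have hττ : klDiv τ τ = 0 := klDiv_self τ
  obtain ⟨hτtop, hτ⟩ := (hc τ hmem).2 (by simp)
  rw [hττ, ENNReal.toReal_zero, mul_zero, zero_add] at hτ
  constructor
  · rintro ⟨hπ, hmin⟩
    have hle : objective ε ρ π ≤ objective ε ρ τ := hmin hmem
    have := hπ.1
    have hne : klDiv π τ ≠ ∞ := fun h => hτtop (top_le_iff.1 ((hc π hπ).1 h ▸ hle))
    have hreal := (ENNReal.toReal_le_toReal ((hc π hπ).2 hne).1 hτtop).2 hle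
    rw [((hc π hπ).2 hne).2, hτ] at hreal
    have h0 : (klDiv π τ).toReal = 0 := by
      have := ENNReal.toReal_nonneg (a := klDiv π τ)
      nlinarith
    exact klDiv_eq_zero_iff.1 (((ENNReal.toReal_eq_zero_iff _).1 h0).resolve_right hne)
  · rintro rfl
    refine ⟨hmem, fun π hπ => ?_⟩
    change objective ε ρ τ ≤ objective ε ρ π
    by_cases hne : klDiv π τ = ∞
    · rw [(hc π hπ).1 hne]; exact le_top
    · rw [← ENNReal.toReal_le_toReal hτtop ((hc π hπ).2 hne).1, ((hc π hπ).2 hne).2, hτ]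
      have := ENNReal.toReal_nonneg (a := klDiv π τ)
      nlinarith [mul_nonneg hε.le this]

end Objective

end EntropicOT

theorem mainTheorem1 (d : ℕ) (A B : Matrix (Fin d) (Fin d) ℝ) (hA : A.PosDef) (hB : B.PosDef)
    (S : Matrix (Fin d ⊕ Fin d) (Fin d ⊕ Fin d) ℝ) (hS : S.PosDef) :
    (∀ᶠ ε in 𝓝[>] (0 : ℝ), IsUnit (EntropicOT.Meps S ε)) ∧
    ∀ ε : ℝ, 0 < ε → IsUnit (EntropicOT.Meps S ε) →
      (EntropicOT.covOf A B (EntropicOT.Ceps A B S ε)).PosSemidef ∧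
      ∀ π : MeasureTheory.Measure (EntropicOT.Space d × EntropicOT.Space d),
        EntropicOT.IsSolution ε (EntropicOT.gaussianProd S)
            (EntropicOT.gaussian A) (EntropicOT.gaussian B) π ↔
          π = EntropicOT.gaussianProd (EntropicOT.covOf A B (EntropicOT.Ceps A B S ε)) := by
  refine ⟨EntropicOT.eventually_isUnit_Meps S, fun ε hε hM => ?_⟩
  obtain ⟨hT, P, Q, hinv⟩ := EntropicOT.covOf_Ceps_posDef_and_inv hA hB S hε hM
  refine ⟨hT.posSemidef, fun π => ?_⟩
  have hmem := EntropicOT.gaussianProd_covOf_mem_couplings hT.posSemidef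
  set T := EntropicOT.covOf A B (EntropicOT.Ceps A B S ε)
  have hsymm : (S⁻¹).toBlocks₂₁ = ((S⁻¹).toBlocks₁₂).transpose := by
    have h : (S⁻¹).transpose = S⁻¹ := hS.inv.isHermitian
    ext i j
    exact congrFun (congrFun h.symm (Sum.inr i)) (Sum.inl j)
  -- `M_ε` is exactly the matrix with `Γ₁₂ + ε⁻¹ M_ε = ε⁻¹ I`.
  have hST : S⁻¹ - T⁻¹ = Matrix.fromBlocks ((S⁻¹).toBlocks₁₁ - P) (ε⁻¹ • 1) (ε⁻¹ • 1)
      ((S⁻¹).toBlocks₂₂ - Q) := by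
    have h₁ : ε⁻¹ • EntropicOT.Meps S ε = ε⁻¹ • 1 - (S⁻¹).toBlocks₁₂ := by
      rw [EntropicOT.Meps, smul_sub, smul_smul, inv_mul_cancel₀ hε.ne', one_smul]
    have h₂ : ε⁻¹ • (EntropicOT.Meps S ε).transpose = ε⁻¹ • 1 - (S⁻¹).toBlocks₂₁ := by
      rw [← Matrix.transpose_smul, h₁, hsymm]
      simp
    rw [hinv, h₁, h₂]
    nth_rewrite 1 [← Matrix.fromBlocks_toBlocks S⁻¹]
    rw [sub_eq_add_neg, Matrix.fromBlocks_neg, Matrix.fromBlocks_add]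
    congr 1 <;> abel
  obtain ⟨a, b, hac, hbc, ha, hb, htilt⟩ := EntropicOT.exists_potentials hS hT hε hST
  rw [htilt] at hmem ⊢
  exact EntropicOT.isSolution_tilted_iff (EntropicOT.integrable_norm_sq_gaussian A)
    (EntropicOT.integrable_norm_sq_gaussian B) hac hbc (ha A) (hb B) hε hmem π
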